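/- For $n\ge 0$ let $\mathcal S_n(321)$ be the set of permutations $\pi$ of $\{1,\dots,n\}$ for which there are no $i<j<k$ with $\pi(i)>\pi(j)>\pi(k)$, let $\mathrm{Des}(\pi)=\{i : 1\le i<n,\ \pi(i)>\pi(i+1)\}$ be the descent set of $\pi$, and let $C_m=\frac{1}{m+1}\binom{2m}{m}$ be the $m$-th Catalan number. Let $x_1,x_2,\dots$ be commuting indeterminates. Then for every $n\ge 0$ the following identity of polynomials with integer coefficients holds: $$\sum_{\pi\in\mathcal S_n(321)}\ \prod_{j\in\mathrm{Des}(\pi)}x_j \;=\; \sum_{T} C_{n-|T|}\prod_{j\in T}(x_j-1),$$ where $T$ ranges over all subsets of $\{1,\dots,n-1\}$ that contain no two consecutive integers (for $n=0$ and $n=1$ the only such $T$ is the empty set). -/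

import Mathlib

namespace Perm321

/-- The set `[n - 1] = {1, ..., n - 1}` of possible descent positions of a permutation of length
`n` (empty for `n = 0` and `n = 1`). -/
def positions (n : ℕ) : Finset ℕ := Finset.Ico 1 n

/-- The descent set of a permutation `π` of length `n`: the set of positions `i`, `1 ≤ i < n`,
with `π(i) > π(i + 1)`. The positions are counted from `1`, as usual, whereas `Fin n` is indexed
from `0`: the one-line entries `π(i)` and `π(i + 1)` are at the indices `i - 1` and `i`. -/
def descentSet {n : ℕ} (π : Equiv.Perm (Fin n)) : Finset ℕ :=
  {i ∈ positions n | ∃ h : i < n, π ⟨i, h⟩ < π ⟨i - 1, (Nat.sub_le i 1).trans_lt h⟩}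

/-- The set of `321`-avoiding permutations of length `n`. -/
def avoiders (n : ℕ) : Finset (Equiv.Perm (Fin n)) :=
  {π | ¬ ∃ i j k : Fin n, i < j ∧ j < k ∧ π j < π i ∧ π k < π j}

/-- The subsets of `{1, ..., n - 1}` that contain no two consecutive elements. -/
def sparseSubsets (n : ℕ) : Finset (Finset ℕ) :=
  {T ∈ (positions n).powerset | ∀ j ∈ T, j + 1 ∉ T}

end Perm321

open Finset

namespace Perm321

/-! Expanding each $x_j$ as $1+(x_j-1)$ reduces the identity to counting the avoiders with
$T\subseteq\mathrm{Des}(\pi)$. There are none unless $T$ is sparse, and then there are $C_{n-|T|}$.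

For the count, grow permutations by appending a last entry. A node of label $m$ has children
labelled $1,\dots,m+1$, so `childSum` is the transfer operator. Forcing a descent at the new
position makes two appended entries act as a single `childSum` (`sum_label_succ_succ_of_insert`).
Thus each element of $T$ saves one iteration, and iterating from the constant 1 gives ballot
numbers, which are Catalan at the root label 0. -/

/-! ### The generating tree of 321-avoiders -/

/-- The permutation of length `n + 1` obtained by appending the value `v` to the one-line notation
of `π`, the values `≥ v` of `π` being shifted up by one. -/
def insertLast {n : ℕ} (v : Fin (n + 1)) (π : Equiv.Perm (Fin n)) : Equiv.Perm (Fin (n + 1)) :=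
  finSuccEquivLast.trans ((Equiv.optionCongr π).trans (finSuccEquiv' v).symm)

@[simp] lemma insertLast_last {n : ℕ} (v : Fin (n + 1)) (π : Equiv.Perm (Fin n)) :
    insertLast v π (Fin.last n) = v := by
  simp [insertLast]

@[simp] lemma insertLast_castSucc {n : ℕ} (v : Fin (n + 1)) (π : Equiv.Perm (Fin n)) (i : Fin n) :
    insertLast v π i.castSucc = v.succAbove (π i) := by
  simp [insertLast]

lemma insertLast_bijective (n : ℕ) :
    Function.Bijective
      (fun p : Equiv.Perm (Fin n) × Fin (n + 1) => insertLast p.2 p.1) := by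
  rw [Fintype.bijective_iff_injective_and_card]
  constructor
  · rintro ⟨π, v⟩ ⟨ρ, w⟩ h
    have hv : v = w := by
      simpa using congrArg (fun σ : Equiv.Perm (Fin (n + 1)) => σ (Fin.last n)) h
    subst hv
    have hπ : π = ρ := by
      ext i : 1
      have := congrArg (fun σ : Equiv.Perm (Fin (n + 1)) => σ i.castSucc) h
      simpa using this
    rw [hπ]
  · simp [Fintype.card_perm, Nat.factorial_succ, mul_comm]

/-- One more than the largest value of `π` that is the smaller value of an inversion, and `0` if
there is no inversion. -/
def inversionBound {n : ℕ} (π : Equiv.Perm (Fin n)) : ℕ :=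
  ({j | ∃ i, i < j ∧ π j < π i} : Finset (Fin n)).sup fun j => (π j : ℕ) + 1

lemma inversionBound_le_iff {n : ℕ} (π : Equiv.Perm (Fin n)) (b : ℕ) :
    inversionBound π ≤ b ↔ ∀ i j, i < j → π j < π i → (π j : ℕ) < b := by
  simp only [inversionBound, Finset.sup_le_iff, Finset.mem_filter, Finset.mem_univ, true_and,
    Nat.succ_le_iff]
  exact ⟨fun h i j hij hπ => h j ⟨i, hij, hπ⟩, fun h j ⟨i, hij, hπ⟩ => h i j hij hπ⟩

lemma inversionBound_le {n : ℕ} (π : Equiv.Perm (Fin n)) : inversionBound π ≤ n :=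
  (inversionBound_le_iff π n).2 fun _ j _ _ => (π j).2

lemma mem_avoiders {n : ℕ} {π : Equiv.Perm (Fin n)} :
    π ∈ avoiders n ↔ ∀ i j k, i < j → j < k → π j < π i → ¬ π k < π j := by
  simp only [avoiders, Finset.mem_filter, Finset.mem_univ, true_and]
  exact ⟨fun h i j k hij hjk h1 h2 => h ⟨i, j, k, hij, hjk, h1, h2⟩,
    fun h ⟨i, j, k, hij, hjk, h1, h2⟩ => h i j k hij hjk h1 h2⟩

lemma succAbove_lt_self_iff {n : ℕ} (v : Fin (n + 1)) (a : Fin n) :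
    v.succAbove a < v ↔ (a : ℕ) < v := by
  rw [Fin.succAbove_lt_iff_castSucc_lt, Fin.lt_def, Fin.val_castSucc]

lemma self_lt_succAbove_iff {n : ℕ} (v : Fin (n + 1)) (a : Fin n) :
    v < v.succAbove a ↔ (v : ℕ) ≤ a := by
  rw [Fin.lt_succAbove_iff_le_castSucc, Fin.le_def, Fin.val_castSucc]

/-- The new entry can only be the last letter of a 321 pattern, so it must exceed the smaller value
of every inversion. -/
lemma insertLast_mem_avoiders {n : ℕ} (v : Fin (n + 1)) (π : Equiv.Perm (Fin n)) :
    insertLast v π ∈ avoiders (n + 1) ↔ π ∈ avoiders n ∧ inversionBound π ≤ v := by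
  rw [inversionBound_le_iff, mem_avoiders, mem_avoiders]
  constructor
  · intro h
    refine ⟨fun i j k hij hjk h1 h2 => ?_, fun i j hij hπ => ?_⟩
    · exact h i.castSucc j.castSucc k.castSucc (by simpa) (by simpa) (by simpa) (by simpa)
    · have := h i.castSucc j.castSucc (Fin.last n) (by simpa) (Fin.castSucc_lt_last j) (by simpa)
      rw [insertLast_last, insertLast_castSucc, self_lt_succAbove_iff] at this
      omega
  · rintro ⟨h, hv⟩ i j k hij hjk
    obtain ⟨i, rfl⟩ := Fin.exists_castSucc_eq.2 ((hij.trans hjk).trans_le (Fin.le_last k)).ne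
    obtain ⟨j, rfl⟩ := Fin.exists_castSucc_eq.2 (hjk.trans_le (Fin.le_last k)).ne
    rw [Fin.castSucc_lt_castSucc_iff] at hij
    induction k using Fin.lastCases with
    | last =>
      intro h1
      rw [insertLast_last, insertLast_castSucc, self_lt_succAbove_iff]
      have := hv i j hij (by simpa using h1)
      omega
    | cast k =>
      intro h1 h2
      exact h i j k hij (by simpa using hjk) (by simpa using h1) (by simpa using h2)

lemma sum_avoiders_succ {n : ℕ} {M : Type*} [AddCommMonoid M]
    (F : Equiv.Perm (Fin (n + 1)) → M) :
    ∑ σ ∈ avoiders (n + 1), F σ =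
      ∑ π ∈ avoiders n, ∑ v : Fin (n + 1),
        if inversionBound π ≤ v then F (insertLast v π) else 0 := by
  have key := (insertLast_bijective n).sum_comp
    (fun σ => if σ ∈ avoiders (n + 1) then F σ else 0)
  rw [Finset.sum_ite_mem, Finset.univ_inter, Fintype.sum_prod_type] at key
  rw [← key, ← Finset.univ_inter (avoiders n), ← Finset.sum_ite_mem]
  refine Finset.sum_congr rfl fun π _ => ?_
  simp only [insertLast_mem_avoiders]
  split_ifs with h <;> simp [h]

lemma inversionBound_insertLast_last {n : ℕ} (π : Equiv.Perm (Fin n)) :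
    inversionBound (insertLast (Fin.last n) π) = inversionBound π := by
  refine eq_of_forall_ge_iff fun b => ?_
  rw [inversionBound_le_iff, inversionBound_le_iff]
  constructor
  · intro h i j hij hπ
    simpa using h i.castSucc j.castSucc (by simpa) (by simpa)
  · intro h i j hij hπ
    obtain ⟨i, rfl⟩ := Fin.exists_castSucc_eq.2 (hij.trans_le (Fin.le_last j)).ne
    induction j using Fin.lastCases with
    | last => simp [(Fin.le_last _).not_gt] at hπ
    | cast j => simpa using h i j (by simpa using hij) (by simpa using hπ)

lemma exists_le_of_lt {n : ℕ} (π : Equiv.Perm (Fin n)) {v : ℕ} (hv : v < n) :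
    ∃ i, v ≤ (π i : ℕ) :=
  ⟨π.symm ⟨v, hv⟩, by simp⟩

/-- A non-maximal last entry is itself the smaller value of an inversion, and it exceeds all earlier
such values. -/
lemma inversionBound_insertLast_castSucc {n : ℕ} (π : Equiv.Perm (Fin n)) (v : Fin n)
    (hv : inversionBound π ≤ v) :
    inversionBound (insertLast v.castSucc π) = v + 1 := by
  apply le_antisymm
  · rw [inversionBound_le_iff] at hv ⊢
    intro i j hij hπ
    obtain ⟨i, rfl⟩ := Fin.exists_castSucc_eq.2 (hij.trans_le (Fin.le_last j)).ne
    induction j using Fin.lastCases with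
    | last => simp
    | cast j =>
      have h1 := hv i j (by simpa using hij) (by simpa using hπ)
      have h2 := (succAbove_lt_self_iff v.castSucc (π j)).2 (by simpa using h1)
      rw [insertLast_castSucc]
      rw [Fin.lt_def, Fin.val_castSucc] at h2
      omega
  · obtain ⟨i, hi⟩ := exists_le_of_lt π v.2
    have := (inversionBound_le_iff (insertLast v.castSucc π) _).1 le_rfl i.castSucc (Fin.last n)
      (Fin.castSucc_lt_last i)
      (by rw [insertLast_last, insertLast_castSucc, self_lt_succAbove_iff]; simpa using hi)
    simpa using this

/-- The number of values of `π` that exceed every smaller value of an inversion. -/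
def label {n : ℕ} (π : Equiv.Perm (Fin n)) : ℕ := n - inversionBound π

lemma sum_ite_le_sub (n b : ℕ) (g : ℕ → ℕ) :
    (∑ v : Fin n, if b ≤ v then g (n - v) else 0) = ∑ j ∈ Icc 1 (n - b), g j := by
  rw [Fin.sum_univ_eq_sum_range (fun v => if b ≤ v then g (n - v) else 0) n, ← Finset.sum_filter]
  refine Finset.sum_bij' (fun v _ => n - v) (fun j _ => n - j) ?_ ?_ ?_ ?_
    (fun _ _ => rfl) <;>
    simp only [Finset.mem_filter, Finset.mem_range, Finset.mem_Icc] <;> intros <;> omega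

lemma sum_label_insertLast_castSucc {n : ℕ} (π : Equiv.Perm (Fin n)) (g : ℕ → ℕ) :
    (∑ v : Fin n, if inversionBound π ≤ v then g (label (insertLast v.castSucc π)) else 0) =
      ∑ j ∈ Icc 1 (label π), g j := by
  rw [label, ← sum_ite_le_sub]
  refine Finset.sum_congr rfl fun v _ => ?_
  split_ifs with h
  · rw [label, inversionBound_insertLast_castSucc π v h, Nat.add_sub_add_right]
  · rfl

lemma label_insertLast_last {n : ℕ} (π : Equiv.Perm (Fin n)) :
    label (insertLast (Fin.last n) π) = label π + 1 := by
  rw [label, label, inversionBound_insertLast_last, Nat.sub_add_comm (inversionBound_le π)]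

lemma sum_label_insertLast {n : ℕ} (π : Equiv.Perm (Fin n)) (g : ℕ → ℕ) :
    (∑ v : Fin (n + 1), if inversionBound π ≤ v then g (label (insertLast v π)) else 0) =
      ∑ j ∈ Icc 1 (label π + 1), g j := by
  rw [Fin.sum_univ_castSucc, Finset.sum_Icc_succ_top (by omega), ← sum_label_insertLast_castSucc,
    label_insertLast_last]
  simp [inversionBound_le]

/-! ### Prescribed descents along the tree -/

lemma mem_descentSet {n : ℕ} {π : Equiv.Perm (Fin n)} {j : ℕ} :
    j ∈ descentSet π ↔
      1 ≤ j ∧ ∃ h : j < n, π ⟨j, h⟩ < π ⟨j - 1, (Nat.sub_le j 1).trans_lt h⟩ := by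
  simp only [descentSet, positions, Finset.mem_filter, Finset.mem_Ico]
  exact ⟨fun h => ⟨h.1.1, h.2⟩, fun h => ⟨⟨h.1, h.2.1⟩, h.2⟩⟩

lemma mem_descentSet_insertLast_of_lt {n : ℕ} (v : Fin (n + 1)) (π : Equiv.Perm (Fin n)) {j : ℕ}
    (hj : j < n) : j ∈ descentSet (insertLast v π) ↔ j ∈ descentSet π := by
  have h1 : (⟨j, by omega⟩ : Fin (n + 1)) = (⟨j, hj⟩ : Fin n).castSucc := rfl
  have h2 : (⟨j - 1, by omega⟩ : Fin (n + 1)) = (⟨j - 1, by omega⟩ : Fin n).castSucc := rfl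
  rw [mem_descentSet, mem_descentSet]
  simp only [h1, h2, insertLast_castSucc, Fin.succAbove_lt_succAbove_iff, hj,
    Nat.lt_succ_of_lt hj, exists_true_left]

lemma subset_descentSet_insertLast_iff {n : ℕ} (v : Fin (n + 1)) (π : Equiv.Perm (Fin n))
    {T : Finset ℕ} (hT : T ⊆ positions n) :
    T ⊆ descentSet (insertLast v π) ↔ T ⊆ descentSet π :=
  forall₂_congr fun _ hj =>
    mem_descentSet_insertLast_of_lt v π (Finset.mem_Ico.1 (hT hj)).2

lemma last_mem_descentSet_insertLast_insertLast {n : ℕ} (v : Fin (n + 2)) (u : Fin (n + 1))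
    (π : Equiv.Perm (Fin n)) :
    n + 1 ∈ descentSet (insertLast v (insertLast u π)) ↔ (v : ℕ) ≤ u := by
  have h1 : (⟨n + 1, by omega⟩ : Fin (n + 2)) = Fin.last (n + 1) := rfl
  have h2 : (⟨n, by omega⟩ : Fin (n + 2)) = (Fin.last n).castSucc := rfl
  rw [mem_descentSet]
  simp only [Nat.add_sub_cancel, h1, h2, insertLast_last, insertLast_castSucc,
    self_lt_succAbove_iff]
  simp

lemma last_mem_descentSet_insertLast_castSucc {n : ℕ} (v : Fin (n + 2)) (u : Fin n)
    (π : Equiv.Perm (Fin n)) (hu : inversionBound π ≤ u)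
    (hv : inversionBound (insertLast u.castSucc π) ≤ v) :
    n + 1 ∉ descentSet (insertLast v (insertLast u.castSucc π)) := by
  rw [inversionBound_insertLast_castSucc π u hu] at hv
  rw [last_mem_descentSet_insertLast_insertLast, Fin.val_castSucc]
  omega

/-- The operator that sums a function over the labels of the children of a permutation in the
generating tree of `321`-avoiding permutations. -/
def childSum (g : ℕ → ℕ) (m : ℕ) : ℕ := ∑ j ∈ Icc 1 (m + 1), g j

lemma sum_label_succ_of_subset {n : ℕ} {T : Finset ℕ} (hT : T ⊆ positions n) (g : ℕ → ℕ) :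
    (∑ σ ∈ avoiders (n + 1), if T ⊆ descentSet σ then g (label σ) else 0) =
      ∑ π ∈ avoiders n, if T ⊆ descentSet π then childSum g (label π) else 0 := by
  rw [sum_avoiders_succ]
  refine Finset.sum_congr rfl fun π _ => ?_
  simp only [subset_descentSet_insertLast_iff _ π hT]
  split_ifs with h
  · exact sum_label_insertLast π g
  · simp

/-- A non-maximal `u` pushes the bound to `u + 1`, forbidding a descent right after it. So `u` is
the maximum, which raises the label by one, and `v` is anything admissible except the new maximum:
the labels are again `1, ..., label π + 1`. -/
lemma sum_label_succ_succ_of_insert {n : ℕ} {T : Finset ℕ} (hT : T ⊆ positions n) (g : ℕ → ℕ) :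
    (∑ σ ∈ avoiders (n + 2), if insert (n + 1) T ⊆ descentSet σ then g (label σ) else 0) =
      ∑ π ∈ avoiders n, if T ⊆ descentSet π then childSum g (label π) else 0 := by
  have hT' : T ⊆ positions (n + 1) := hT.trans (Finset.Ico_subset_Ico_right n.le_succ)
  rw [sum_avoiders_succ, sum_avoiders_succ]
  refine Finset.sum_congr rfl fun π _ => ?_
  simp only [Finset.insert_subset_iff, subset_descentSet_insertLast_iff _ _ hT',
    subset_descentSet_insertLast_iff _ π hT]
  by_cases h : T ⊆ descentSet π
  · simp only [h, and_true, if_true]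
    rw [Fin.sum_univ_castSucc, Finset.sum_eq_zero, zero_add, if_pos (by simp [inversionBound_le]),
      Fin.sum_univ_castSucc, childSum, ← label_insertLast_last, ← sum_label_insertLast_castSucc]
    · simp [last_mem_descentSet_insertLast_insertLast, Nat.lt_succ_iff.1 (Fin.is_lt _)]
    · intro u _
      split_ifs with hu
      · refine Finset.sum_eq_zero fun v _ => ?_
        split_ifs with hv hd
        · exact absurd hd (last_mem_descentSet_insertLast_castSucc v u π hu hv)
        · rfl
        · rfl
      · rfl
  · simp [h]

/-- The weight `g` is arbitrary because the induction replaces it by `childSum g`. -/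
lemma sum_label_eq_iterate (n : ℕ) : ∀ T ∈ sparseSubsets n, ∀ g : ℕ → ℕ,
    (∑ π ∈ avoiders n, if T ⊆ descentSet π then g (label π) else 0) =
      childSum^[n - T.card] g 0 := by
  induction n using Nat.strong_induction_on with
  | _ n ih =>
    intro T hT g
    simp only [sparseSubsets, Finset.mem_filter, Finset.mem_powerset] at hT ih
    obtain ⟨hT, hs⟩ := hT
    have hcard : T.card ≤ n - 1 := by simpa [positions] using Finset.card_le_card hT
    match n with
    | 0 =>
      obtain rfl : T = ∅ := by simpa [positions] using hT
      simp [avoiders, label]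
    | n + 1 =>
      by_cases hn : n ∈ T
      · obtain ⟨k, rfl⟩ : ∃ k, n = k + 1 :=
          ⟨n - 1, by have := (Finset.mem_Ico.1 (hT hn)).1; omega⟩
        obtain ⟨S, hS, rfl⟩ : ∃ S, k + 1 ∉ S ∧ insert (k + 1) S = T :=
          ⟨T.erase (k + 1), Finset.notMem_erase _ _, Finset.insert_erase hn⟩
        have hSk : S ⊆ positions k := fun j hj => by
          have h1 := Finset.mem_Ico.1 (hT (Finset.mem_insert_of_mem hj))
          have h2 : j ≠ k + 1 := fun h => hS (h ▸ hj)
          -- Sparsity excludes `k`, so the last two entries can be removed together.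
          have h3 : j ≠ k := fun h =>
            hs j (Finset.mem_insert_of_mem hj) (by rw [h]; exact Finset.mem_insert_self _ _)
          exact Finset.mem_Ico.2 ⟨h1.1, by omega⟩
        rw [sum_label_succ_succ_of_insert hSk, ih k (by omega) S ⟨hSk, fun j hj hj' =>
          hs j (Finset.mem_insert_of_mem hj) (Finset.mem_insert_of_mem hj')⟩,
          ← Function.iterate_succ_apply]
        rw [Finset.card_insert_of_notMem hS] at hcard ⊢
        rw [show (k - S.card).succ = k + 1 + 1 - (S.card + 1) by omega]
      · have hTn : T ⊆ positions n := fun j hj => by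
          have h1 := Finset.mem_Ico.1 (hT hj)
          have h2 : j ≠ n := fun h => hn (h ▸ hj)
          exact Finset.mem_Ico.2 ⟨h1.1, by omega⟩
        rw [sum_label_succ_of_subset hTn, ih n (by omega) T ⟨hTn, hs⟩,
          ← Function.iterate_succ_apply]
        rw [show (n - T.card).succ = n + 1 - T.card by omega]

/-! ### Ballot and Catalan numbers -/

lemma childSum_zero (g : ℕ → ℕ) : childSum g 0 = g 1 := by simp [childSum]

lemma childSum_succ (g : ℕ → ℕ) (m : ℕ) : childSum g (m + 1) = childSum g m + g (m + 2) := by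
  rw [childSum, Finset.sum_Icc_succ_top (by omega), childSum]

/-- Ballot numbers, by Pascal's rule in both indices; the boundary `m = 0` also uses the symmetry of
binomials. -/
lemma iterate_childSum_one_add_choose (k m : ℕ) :
    childSum^[k + 1] (fun _ => 1) m + (2 * k + 2 + m).choose k =
      (2 * k + 2 + m).choose (k + 1) := by
  induction k generalizing m with
  | zero => simp [childSum]; omega
  | succ k ih =>
    rw [Function.iterate_succ_apply']
    induction m with
    | zero =>
      have h := ih 1
      have h1 := Nat.choose_succ_succ' (2 * k + 3) (k + 1)
      have h2 := Nat.choose_succ_succ' (2 * k + 3) k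
      have h3 : (2 * k + 3).choose (k + 2) = (2 * k + 3).choose (k + 1) :=
        Nat.choose_symm_of_eq_add (by omega)
      rw [childSum_zero]
      ring_nf at h h1 h2 h3 ⊢
      omega
    | succ m ihm =>
      have h := ih (m + 2)
      have h1 := Nat.choose_succ_succ' (2 * k + 4 + m) (k + 1)
      have h2 := Nat.choose_succ_succ' (2 * k + 4 + m) k
      rw [childSum_succ]
      ring_nf at h h1 h2 ihm ⊢
      omega

lemma catalan_succ_add_choose (k : ℕ) :
    catalan (k + 1) + (2 * k + 2).choose k = (2 * k + 2).choose (k + 1) := by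
  have h1 := succ_mul_catalan_eq_centralBinom (k + 1)
  have h2 := Nat.choose_succ_right_eq (2 * k + 2) k
  rw [Nat.centralBinom, show 2 * (k + 1) = 2 * k + 2 by ring] at h1
  rw [show 2 * k + 2 - k = k + 2 by omega] at h2
  refine Nat.eq_of_mul_eq_mul_left (Nat.succ_pos (k + 1)) ?_
  rw [Nat.succ_eq_add_one]
  linarith

lemma iterate_childSum_one_zero (k : ℕ) : childSum^[k] (fun _ => 1) 0 = catalan k := by
  cases k with
  | zero => simp
  | succ k =>
    have h := iterate_childSum_one_add_choose k 0
    rw [add_zero, ← catalan_succ_add_choose] at h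
    exact Nat.add_right_cancel h

lemma sum_subset_descentSet_eq_catalan {n : ℕ} {T : Finset ℕ} (hT : T ∈ sparseSubsets n) :
    (∑ π ∈ avoiders n, if T ⊆ descentSet π then 1 else 0) = catalan (n - T.card) := by
  rw [← iterate_childSum_one_zero]
  exact sum_label_eq_iterate n T hT fun _ => 1

/-- Descents at `j` and `j + 1` would form a 321 pattern in three adjacent entries. -/
lemma mem_sparseSubsets_of_subset_descentSet {n : ℕ} {π : Equiv.Perm (Fin n)}
    (hπ : π ∈ avoiders n) {T : Finset ℕ} (hT : T ⊆ descentSet π) : T ∈ sparseSubsets n := by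
  refine Finset.mem_filter.2
    ⟨Finset.mem_powerset.2 (hT.trans (Finset.filter_subset _ _)), fun j hj hj' => ?_⟩
  obtain ⟨h0, h1, h2⟩ := mem_descentSet.1 (hT hj)
  obtain ⟨-, h3, h4⟩ := mem_descentSet.1 (hT hj')
  refine mem_avoiders.1 hπ _ _ _ ?_ ?_ h2 h4 <;> simp only [Fin.lt_def] <;> omega

end Perm321

theorem mainTheorem8 (n : ℕ) :
    ∑ π ∈ Perm321.avoiders n, ∏ j ∈ Perm321.descentSet π, (MvPolynomial.X j : MvPolynomial ℕ ℤ) =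
      ∑ T ∈ Perm321.sparseSubsets n,
        (catalan (n - T.card) : MvPolynomial ℕ ℤ) * ∏ j ∈ T, (MvPolynomial.X j - 1) := by
  have expand : ∀ π ∈ Perm321.avoiders n,
      ∏ j ∈ Perm321.descentSet π, (MvPolynomial.X j : MvPolynomial ℕ ℤ) =
        ∑ T ∈ Perm321.sparseSubsets n,
          (if T ⊆ Perm321.descentSet π then 1 else 0) * ∏ j ∈ T, (MvPolynomial.X j - 1) := by
    intro π hπ
    have h := Finset.prod_one_add (f := fun j => (MvPolynomial.X j - 1 : MvPolynomial ℕ ℤ))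
      (Perm321.descentSet π)
    simp only [add_sub_cancel] at h
    simp only [h, ite_mul, one_mul, zero_mul]
    rw [← Finset.sum_filter]
    refine Finset.sum_congr (Finset.ext fun T => ?_) fun _ _ => rfl
    rw [Finset.mem_powerset, Finset.mem_filter]
    exact ⟨fun hT => ⟨Perm321.mem_sparseSubsets_of_subset_descentSet hπ hT, hT⟩, fun hT => hT.2⟩
  rw [Finset.sum_congr rfl expand, Finset.sum_comm]
  refine Finset.sum_congr rfl fun T hT => ?_
  rw [← Finset.sum_mul, ← Perm321.sum_subset_descentSet_eq_catalan hT]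
  push_cast
  rfl
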